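/- Let $\mathbb{D}$ be the open unit disc, $\mathbb{T}$ the unit circle with normalised Lebesgue measure $m$, and $H^2\subset L^2(\mathbb{T})$ the Hardy space (functions holomorphic on $\mathbb{D}$ with $\sup_{0\le r<1}\int_{\mathbb{T}}|f(r\zeta)|^2\,dm(\zeta)<\infty$, identified with their boundary functions). Let $H^\infty$ be the space of bounded holomorphic functions on $\mathbb{D}$. For $\psi\in H^\infty$ let $T_\psi f=P_+(\psi f)$, $f\in H^2$, be the analytic Toeplitz operator with symbol $\psi$, where $\psi$ is identified with its boundary function in $L^\infty(\mathbb{T})$ and $P_+$ is the orthogonal projection of $L^2(\mathbb{T})$ onto $H^2$. Let $\varphi\in H^\infty$ be an outer function, i.e. there are $\gamma\in\mathbb{R}$ and $k:\mathbb{T}\to\mathbb{R}$ with $k>0$ almost everywhere and $\log k\in L^1(\mathbb{T})$ such that $$\varphi(z)=e^{i\gamma}\exp\left(\int_{\mathbb{T}}\frac{\zeta+z}{\zeta-z}\log k(\zeta)\,dm(\zeta)\right),\qquad z\in\mathbb{D}.$$ Then $T_\varphi$ is embeddable into a $C_0$-semigroup of analytic Toeplitz operators on $H^2$: there is a $C_0$-semigroup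 $(S_t)_{t\ge0}$ of bounded operators on $H^2$ with $S_1=T_\varphi$, such that every $S_t$ is of the form $T_\psi$ with $\psi\in H^\infty$. More precisely, for every such representation of $\varphi$, the functions $$\varphi_t(z)=\exp\left(t\left(i\gamma+\int_{\mathbb{T}}\frac{\zeta+z}{\zeta-z}\log k(\zeta)\,dm(\zeta)\right)\right),\qquad z\in\mathbb{D},\ t\ge0,$$ belong to $H^\infty$, $\varphi_1=\varphi$, and $(T_{\varphi_t})_{t\ge0}$ is a $C_0$-semigroup on $H^2$ with $T_{\varphi_1}=T_\varphi$. -/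

import Mathlib

open MeasureTheory Filter Topology Set
open scoped NNReal ENNReal

noncomputable section

/-! ### Strongly continuous semigroups -/

/-- A family `(S t)`, `t ≥ 0`, of bounded operators on a Banach space is a `C₀`-semigroup if
`S 0 = Id`, `S (t + s) = S t ∘ S s`, and every orbit `t ↦ S t x` is continuous. -/
structure IsC0Semigroup {E : Type*} [NormedAddCommGroup E] [NormedSpace ℂ E]
    (S : ℝ≥0 → E →L[ℂ] E) : Prop where
  map_zero : S 0 = ContinuousLinearMap.id ℂ E
  map_add : ∀ t s : ℝ≥0, S (t + s) = (S t).comp (S s)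
  continuous_orbit : ∀ x : E, Continuous fun t : ℝ≥0 => S t x

/-! ### The unit circle and the disc

The unit circle `𝕋` is parametrised by `UnitAddCircle = ℝ / ℤ` through
`θ ↦ AddCircle.toCircle θ = exp (2 π i θ)`.  Under this parametrisation the normalised Lebesgue
measure of `𝕋` is the Haar probability measure `circleMeasure`. -/

/-- Normalised Lebesgue measure on the unit circle. -/
abbrev circleMeasure : Measure UnitAddCircle := AddCircle.haarAddCircle

/-- The point `exp (2 π i θ)` of the unit circle. -/
def circlePoint (θ : UnitAddCircle) : ℂ := (AddCircle.toCircle θ : ℂ)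

/-- The open unit disc. -/
abbrev unitDisc : Set ℂ := Metric.ball (0 : ℂ) 1

/-- The dilated function `ζ ↦ F (r ζ)` on the unit circle. -/
def dilate (F : ℂ → ℂ) (r : ℝ) : UnitAddCircle → ℂ := fun θ => F (r * circlePoint θ)

/-- `g` is the boundary function of `F`: the dilates `F (r ·)` tend to `g` in `L²(𝕋)` as
`r → 1⁻`. -/
def HasBoundaryFunction (F : ℂ → ℂ) (g : UnitAddCircle → ℂ) : Prop :=
  Tendsto (fun r : ℝ => eLpNorm (dilate F r - g) 2 circleMeasure) (𝓝[<] 1) (𝓝 0)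

/-- Membership in the Hardy space `H²(𝔻)`: `F` is holomorphic on the disc and the means
`∫ |F (r ζ)|² dm(ζ)`, `0 ≤ r < 1`, are bounded. (Only the values of `F` on the disc matter.) -/
def MemHardyTwo (F : ℂ → ℂ) : Prop :=
  DifferentiableOn ℂ F unitDisc ∧
    ∃ C : ℝ, ∀ r : ℝ, 0 ≤ r → r < 1 → ∫ θ, ‖dilate F r θ‖ ^ 2 ∂circleMeasure ≤ C

/-- Membership in `H^∞(𝔻)`: bounded and holomorphic on the disc. -/
def MemHInfty (F : ℂ → ℂ) : Prop :=
  DifferentiableOn ℂ F unitDisc ∧ ∃ C : ℝ, ∀ z ∈ unitDisc, ‖F z‖ ≤ C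

/-! ### Taylor and Fourier coefficients -/

/-- Extension of a sequence indexed by `ℕ` to `ℤ` by zero. -/
def zcoef (b : ℕ → ℂ) : ℤ → ℂ
  | Int.ofNat n => b n
  | Int.negSucc _ => 0

/-- `a` is the sequence of Taylor coefficients of `F` on the disc. -/
def TaylorOnDisc (F : ℂ → ℂ) (a : ℕ → ℂ) : Prop :=
  ∀ z ∈ unitDisc, HasSum (fun n => a n * z ^ n) (F z)

theorem norm_circlePoint (θ : UnitAddCircle) : ‖circlePoint θ‖ = 1 := Circle.norm_coe _

theorem mul_circlePoint_mem {r : ℝ} (h0 : 0 ≤ r) (h1 : r < 1) (θ : UnitAddCircle) :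
    (r : ℂ) * circlePoint θ ∈ unitDisc := by
  simp [norm_circlePoint, abs_of_nonneg h0, h1]

theorem exists_taylorOnDisc {F : ℂ → ℂ} (hF : DifferentiableOn ℂ F unitDisc) :
    ∃ a, TaylorOnDisc F a := by
  refine ⟨fun n => (n.factorial : ℂ)⁻¹ * iteratedDeriv n F 0, fun z hz => ?_⟩
  have := Complex.hasSum_taylorSeries_on_ball (f := F) (c := 0) (r := 1) (by simpa using hF)
    (z := z) (by simpa using hz)
  simpa [mul_comm, mul_left_comm, mul_assoc] using this

theorem TaylorOnDisc.summable_norm {F : ℂ → ℂ} {a : ℕ → ℂ} (ha : TaylorOnDisc F a) {r : ℝ}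
    (h0 : 0 ≤ r) (h1 : r < 1) : Summable fun n => ‖a n * (r : ℂ) ^ n‖ := by
  have hr : (r : ℂ) ∈ unitDisc := by simp [abs_of_nonneg h0, h1]
  exact (ha _ hr).summable.norm

theorem TaylorOnDisc.exists_continuous {F : ℂ → ℂ} {a : ℕ → ℂ} (ha : TaylorOnDisc F a) {r : ℝ}
    (h0 : 0 ≤ r) (h1 : r < 1) :
    ∃ G : C(UnitAddCircle, ℂ), ⇑G = dilate F r ∧
      ∀ k, fourierBasis.repr (ContinuousMap.toLp 2 circleMeasure ℂ G) k
        = zcoef (fun n => a n * (r : ℂ) ^ n) k := by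
  have hs : Summable fun n : ℕ =>
      (a n * (r : ℂ) ^ n) • (fourier (n : ℤ) : C(UnitAddCircle, ℂ)) := by
    refine Summable.of_norm ?_
    simpa [norm_smul, fourier_norm] using ha.summable_norm h0 h1
  obtain ⟨G, hG⟩ := hs
  refine ⟨G, ?_, fun k => ?_⟩
  · funext θ
    have h1' := (ContinuousMap.evalCLM ℂ θ).hasSum hG
    have h2' := ha _ (mul_circlePoint_mem h0 h1 θ)
    refine h1'.unique ?_
    have he : ∀ n : ℕ, ContinuousMap.evalCLM ℂ θ
        ((a n * (r : ℂ) ^ n) • (fourier (n : ℤ) : C(UnitAddCircle, ℂ)))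
          = a n * ((r : ℂ) * circlePoint θ) ^ n := by
      intro n
      have : ((AddCircle.toCircle (n • θ) : Circle) : ℂ) = circlePoint θ ^ n := by
        rw [AddCircle.toCircle_nsmul, Circle.coe_pow]; rfl
      simp [this, mul_pow, mul_assoc]
    simp only [he]
    exact h2'
  · have h1' := ((innerSL ℂ (fourierLp 2 k : Lp ℂ 2 circleMeasure)).comp
      (ContinuousMap.toLp 2 circleMeasure ℂ)).hasSum hG
    have hval : ∀ n : ℕ, ((innerSL ℂ (fourierLp 2 k : Lp ℂ 2 circleMeasure)).comp
        (ContinuousMap.toLp 2 circleMeasure ℂ))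
          ((a n * (r : ℂ) ^ n) • (fourier (n : ℤ) : C(UnitAddCircle, ℂ)))
        = if k = n then a n * (r : ℂ) ^ n else 0 := by
      intro n
      have := (orthonormal_iff_ite.mp (orthonormal_fourier (T := (1 : ℝ)))) k n
      rw [ContinuousLinearMap.comp_apply, map_smul, map_smul, innerSL_apply_apply, this]
      split_ifs <;> simp
    have h2' : fourierBasis.repr (ContinuousMap.toLp 2 circleMeasure ℂ G) k
        = ((innerSL ℂ (fourierLp 2 k : Lp ℂ 2 circleMeasure)).comp
      (ContinuousMap.toLp 2 circleMeasure ℂ)) G := by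
      rw [HilbertBasis.repr_apply_apply, coe_fourierBasis]; rfl
    rw [h2']
    refine h1'.unique ?_
    simp only [hval]
    cases k with
    | ofNat m =>
      have h3 := hasSum_single
        (f := fun n : ℕ => if (Int.ofNat m) = (n : ℤ) then a n * (r : ℂ) ^ n else 0) m
        fun n hn => if_neg fun h => hn (Int.ofNat.inj h).symm
      have h4 : (if (Int.ofNat m) = (m : ℤ) then a m * (r : ℂ) ^ m else 0)
          = zcoef (fun n => a n * (r : ℂ) ^ n) (Int.ofNat m) := if_pos rfl
      rw [h4] at h3
      exact h3
    | negSucc m =>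
      have : ∀ n : ℕ, ¬ (Int.negSucc m = (n : ℤ)) := fun n => by omega
      simp only [this, if_false, zcoef]
      exact hasSum_zero

theorem hasSum_normSq_of_repr {f : Lp ℂ 2 circleMeasure} {b : ℕ → ℂ}
    (hf : ∀ k, fourierBasis.repr f k = zcoef b k) : HasSum (fun n => ‖b n‖ ^ 2) (‖f‖ ^ 2) := by
  have h1 := lp.hasSum_norm (p := 2) (by norm_num) (fourierBasis.repr f)
  rw [LinearIsometryEquiv.norm_map] at h1
  simp only [ENNReal.toReal_ofNat, Real.rpow_ofNat, hf] at h1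
  have h2 := (Function.Injective.hasSum_iff (g := fun n : ℕ => (n : ℤ))
    Nat.cast_injective (f := fun k => ‖zcoef b k‖ ^ 2) (a := ‖f‖ ^ 2) ?_).2 h1
  · exact h2
  · intro k hk
    cases k with
    | ofNat m => exact absurd ⟨m, rfl⟩ hk
    | negSucc m => simp [zcoef]

theorem exists_repr_eq_zcoef {a : ℕ → ℂ} (ha : Summable fun n => ‖a n‖ ^ 2) :
    ∃ g : Lp ℂ 2 circleMeasure, ∀ k, fourierBasis.repr g k = zcoef a k := by
  have hm : Memℓp (zcoef a) 2 := by
    refine memℓp_gen ?_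
    simp only [ENNReal.toReal_ofNat, Real.rpow_ofNat]
    refine (Function.Injective.summable_iff (g := fun n : ℕ => (n : ℤ))
      Nat.cast_injective (f := fun k => ‖zcoef a k‖ ^ 2) ?_).1 ha
    intro k hk
    cases k with
    | ofNat m => exact absurd ⟨m, rfl⟩ hk
    | negSucc m => simp [zcoef]
  refine ⟨fourierBasis.repr.symm ⟨zcoef a, hm⟩, fun k => ?_⟩
  rw [LinearIsometryEquiv.apply_symm_apply]

theorem zcoef_sub (a b : ℕ → ℂ) (k : ℤ) : zcoef a k - zcoef b k = zcoef (fun n => a n - b n) k := by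
  cases k <;> simp [zcoef]

theorem eLpNorm_dilate_sub {F : ℂ → ℂ} {r : ℝ} {G : C(UnitAddCircle, ℂ)} (hG : ⇑G = dilate F r)
    (g : Lp ℂ 2 circleMeasure) :
    eLpNorm (dilate F r - (g : UnitAddCircle → ℂ)) 2 circleMeasure
      = ‖ContinuousMap.toLp 2 circleMeasure ℂ G - g‖ₑ := by
  rw [Lp.enorm_def]
  refine eLpNorm_congr_ae ?_
  filter_upwards [Lp.coeFn_sub (ContinuousMap.toLp 2 circleMeasure ℂ G) g,
    ContinuousMap.coeFn_toLp (p := 2) (𝕜 := ℂ) circleMeasure G] with θ h1 h2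
  rw [h1, Pi.sub_apply, Pi.sub_apply, h2, hG]

theorem eventually_radius : ∀ᶠ r : ℝ in 𝓝[<] 1, 0 ≤ r ∧ r < 1 := by
  filter_upwards [Ioo_mem_nhdsLT (show (0 : ℝ) < 1 by norm_num)] with r hr
  exact ⟨hr.1.le, hr.2⟩

theorem TaylorOnDisc.hasBoundaryFunction {F : ℂ → ℂ} {a : ℕ → ℂ} (ha : TaylorOnDisc F a)
    {g : Lp ℂ 2 circleMeasure} (hg : ∀ k, fourierBasis.repr g k = zcoef a k) :
    HasBoundaryFunction F g := by
  have hsum := (hasSum_normSq_of_repr hg).summable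
  have key : Tendsto (fun r : ℝ => ∑' n, ‖a n * (r : ℂ) ^ n - a n‖ ^ 2) (𝓝[<] 1)
      (𝓝 (∑' _ : ℕ, (0 : ℝ))) := by
    refine tendsto_tsum_of_dominated_convergence (bound := fun n => ‖a n‖ ^ 2) hsum ?_ ?_
    · intro n
      have hc : Continuous fun r : ℝ => ‖a n * (r : ℂ) ^ n - a n‖ ^ 2 := by fun_prop
      have := (hc.tendsto 1).mono_left (nhdsWithin_le_nhds (s := Iio (1 : ℝ)))
      simpa using this
    · filter_upwards [eventually_radius] with r hr n
      have h1 : a n * (r : ℂ) ^ n - a n = a n * (((r ^ n - 1 : ℝ)) : ℂ) := by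
        push_cast; ring
      rw [h1, norm_mul, Complex.norm_real, Real.norm_eq_abs, Real.norm_eq_abs,
        abs_of_nonneg (by positivity), mul_pow]
      have h2 : 0 ≤ r ^ n := pow_nonneg hr.1 n
      have h3 : r ^ n ≤ 1 := pow_le_one₀ hr.1 hr.2.le
      have h4 : |r ^ n - 1| ^ 2 ≤ 1 := by
        rw [sq_abs]; nlinarith
      exact mul_le_of_le_one_right (by positivity) h4
  rw [tsum_zero] at key
  have key2 := (ENNReal.tendsto_ofReal (key.sqrt))
  rw [Real.sqrt_zero, ENNReal.ofReal_zero] at key2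
  refine key2.congr' ?_
  filter_upwards [eventually_radius] with r hr
  obtain ⟨G, hG, hc⟩ := ha.exists_continuous hr.1 hr.2
  rw [eLpNorm_dilate_sub hG]
  have h5 : HasSum (fun n => ‖a n * (r : ℂ) ^ n - a n‖ ^ 2)
      (‖ContinuousMap.toLp 2 circleMeasure ℂ G - g‖ ^ 2) := by
    refine hasSum_normSq_of_repr (b := fun n => a n * (r : ℂ) ^ n - a n) fun k => ?_
    rw [map_sub, lp.coeFn_sub, Pi.sub_apply, hc, hg, zcoef_sub]
  rw [h5.tsum_eq, Real.sqrt_sq (norm_nonneg _), ofReal_norm]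

theorem TaylorOnDisc.repr_eq {F : ℂ → ℂ} {a : ℕ → ℂ} (ha : TaylorOnDisc F a)
    {g : Lp ℂ 2 circleMeasure} (hg : HasBoundaryFunction F g) (k : ℤ) :
    fourierBasis.repr g k = zcoef a k := by
  have hcont : Tendsto (fun r : ℝ => zcoef (fun n => a n * (r : ℂ) ^ n) k) (𝓝[<] 1)
      (𝓝 (zcoef a k)) := by
    cases k with
    | ofNat n =>
      have hc : Continuous fun r : ℝ => a n * (r : ℂ) ^ n := by fun_prop
      have := (hc.tendsto 1).mono_left (nhdsWithin_le_nhds (s := Iio (1 : ℝ)))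
      simpa [zcoef] using this
    | negSucc n => simp [zcoef]
  refine tendsto_nhds_unique ?_ hcont
  rw [tendsto_iff_edist_tendsto_0]
  refine tendsto_of_tendsto_of_tendsto_of_le_of_le' tendsto_const_nhds hg
    (Eventually.of_forall fun _ => zero_le) ?_
  filter_upwards [eventually_radius] with r hr
  obtain ⟨G, hG, hc⟩ := ha.exists_continuous hr.1 hr.2
  rw [eLpNorm_dilate_sub hG, ← hc, edist_eq_enorm_sub, ← Pi.sub_apply, ← lp.coeFn_sub, ← map_sub,
    ← LinearIsometryEquiv.enorm_map fourierBasis.repr]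
  rw [← ofReal_norm, ← ofReal_norm]
  exact ENNReal.ofReal_le_ofReal (lp.norm_apply_le_norm (by norm_num) _ k)

theorem MemHardyTwo.summable {F : ℂ → ℂ} (hF : MemHardyTwo F) {a : ℕ → ℂ}
    (ha : TaylorOnDisc F a) : Summable fun n => ‖a n‖ ^ 2 := by
  obtain ⟨-, C, hC⟩ := hF
  refine summable_of_sum_le (c := C) (fun _ => by positivity) fun u => ?_
  have hc : Continuous fun r : ℝ => ∑ n ∈ u, ‖a n * (r : ℂ) ^ n‖ ^ 2 := by fun_prop
  have ht := (hc.tendsto 1).mono_left (nhdsWithin_le_nhds (s := Iio (1 : ℝ)))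
  simp only [Complex.ofReal_one, one_pow, mul_one] at ht
  refine le_of_tendsto ht ?_
  filter_upwards [eventually_radius] with r hr
  obtain ⟨G, hG, hco⟩ := ha.exists_continuous hr.1 hr.2
  have hs := hasSum_normSq_of_repr hco
  refine (sum_le_hasSum u (fun _ _ => by positivity) hs).trans ?_
  refine le_trans (le_of_eq ?_) (hC r hr.1 hr.2)
  rw [← hG]
  have h2 : ‖ContinuousMap.toLp 2 circleMeasure ℂ G‖ ^ 2
      = ∫ θ, ‖ContinuousMap.toLp 2 circleMeasure ℂ G θ‖ ^ 2 ∂circleMeasure := by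
    have h3 := inner_self_eq_norm_sq (𝕜 := ℂ) (ContinuousMap.toLp 2 circleMeasure ℂ G)
    rw [← h3, L2.inner_def, ← integral_re (L2.integrable_inner _ _)]
    exact integral_congr_ae (ae_of_all _ fun θ => inner_self_eq_norm_sq (𝕜 := ℂ) _)
  rw [h2]
  refine integral_congr_ae ?_
  filter_upwards [ContinuousMap.coeFn_toLp (p := 2) (𝕜 := ℂ) circleMeasure G] with θ h
  rw [h]

theorem MemHInfty.memHardyTwo {F : ℂ → ℂ} (hF : MemHInfty F) : MemHardyTwo F := by
  obtain ⟨hd, C, hC⟩ := hF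
  refine ⟨hd, C ^ 2, fun r h0 h1 => ?_⟩
  have hb : ∀ θ, ‖dilate F r θ‖ ^ 2 ≤ C ^ 2 := fun θ =>
    pow_le_pow_left₀ (norm_nonneg _) (hC _ (mul_circlePoint_mem h0 h1 θ)) 2
  calc ∫ θ, ‖dilate F r θ‖ ^ 2 ∂circleMeasure ≤ ∫ _, C ^ 2 ∂circleMeasure :=
        integral_mono_of_nonneg (ae_of_all _ fun _ => by positivity) (integrable_const _)
          (ae_of_all _ hb)
    _ = C ^ 2 := by simp

theorem MemHardyTwo.exists_boundary {F : ℂ → ℂ} (hF : MemHardyTwo F) :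
    ∃ g : Lp ℂ 2 circleMeasure, HasBoundaryFunction F g := by
  obtain ⟨a, ha⟩ := exists_taylorOnDisc hF.1
  obtain ⟨g, hg⟩ := exists_repr_eq_zcoef (hF.summable ha)
  exact ⟨g, ha.hasBoundaryFunction hg⟩

/-- Every function of `H^∞(𝔻)` has a boundary function in `L^∞(𝕋)`. -/
theorem MemHInfty.exists_boundary {F : ℂ → ℂ} (hF : MemHInfty F) :
    ∃ g : Lp ℂ ∞ circleMeasure, HasBoundaryFunction F g := by
  obtain ⟨g, hg⟩ := hF.memHardyTwo.exists_boundary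
  obtain ⟨a, ha⟩ := exists_taylorOnDisc hF.1
  obtain ⟨-, C, hC⟩ := hF
  let r : ℕ → ℝ := fun n => 1 - 1 / ((n : ℝ) + 1)
  have hr0 : ∀ n, 0 ≤ r n := fun n => by
    have : 1 / ((n : ℝ) + 1) ≤ 1 := by
      rw [div_le_one (by positivity)]; linarith [n.cast_nonneg (α := ℝ)]
    simp only [r]; linarith
  have hr1 : ∀ n, r n < 1 := fun n => by
    have : 0 < 1 / ((n : ℝ) + 1) := by positivity
    simp only [r]; linarith
  have hr : Tendsto r atTop (𝓝[<] 1) := by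
    refine tendsto_nhdsWithin_iff.2 ⟨?_, Eventually.of_forall hr1⟩
    simpa [r] using (tendsto_one_div_add_atTop_nhds_zero_nat (𝕜 := ℝ)).const_sub 1
  have hmeas : ∀ n, AEStronglyMeasurable (dilate F (r n)) circleMeasure := fun n => by
    obtain ⟨G, hG, -⟩ := ha.exists_continuous (hr0 n) (hr1 n)
    rw [← hG]; exact G.continuous.aestronglyMeasurable
  have hm := tendstoInMeasure_of_tendsto_eLpNorm (p := 2) (by norm_num) hmeas
    (Lp.aestronglyMeasurable g) (hg.comp hr)
  obtain ⟨ns, -, hns⟩ := hm.exists_seq_tendsto_ae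
  have hb : ∀ᵐ θ ∂circleMeasure, ‖g θ‖ ≤ C := by
    filter_upwards [hns] with θ hθ
    exact le_of_tendsto hθ.norm (Eventually.of_forall fun i =>
      hC _ (mul_circlePoint_mem (hr0 _) (hr1 _) θ))
  have hmem : MemLp g ∞ circleMeasure := memLp_top_of_bound (Lp.aestronglyMeasurable g) C hb
  refine ⟨hmem.toLp g, ?_⟩
  refine Tendsto.congr (fun r => eLpNorm_congr_ae ?_) hg
  filter_upwards [hmem.coeFn_toLp] with θ h
  rw [Pi.sub_apply, Pi.sub_apply, h]

/-- The boundary functions of `H²(𝔻)` are the functions of `L²(𝕋)` without negative Fourier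
coefficients. -/
theorem hardy_boundary_iff (g : Lp ℂ 2 circleMeasure) :
    (∃ F, MemHardyTwo F ∧ HasBoundaryFunction F g) ↔ ∀ k < 0, fourierBasis.repr g k = 0 := by
  constructor
  · rintro ⟨F, hF, hg⟩ k hk
    obtain ⟨a, ha⟩ := exists_taylorOnDisc hF.1
    rw [ha.repr_eq hg]
    cases k with
    | ofNat n => simp at hk; omega
    | negSucc n => rfl
  · intro h
    let a : ℕ → ℂ := fun n => fourierBasis.repr g n
    have hrep : ∀ k, fourierBasis.repr g k = zcoef a k := by
      intro k
      cases k with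
      | ofNat n => rfl
      | negSucc n => exact h _ (Int.negSucc_lt_zero n)
    have hsq := hasSum_normSq_of_repr hrep
    have hbd : ∀ n, ‖a n‖ ≤ ‖g‖ := fun n => by
      have := lp.norm_apply_le_norm (p := 2) (by norm_num) (fourierBasis.repr g) (n : ℤ)
      rwa [LinearIsometryEquiv.norm_map] at this
    have hterm : ∀ (ρ : ℝ) (n : ℕ) (z : ℂ), ‖z‖ ≤ ρ → ‖a n * z ^ n‖ ≤ ‖g‖ * ρ ^ n := by
      intro ρ n z hz
      rw [norm_mul, norm_pow]
      exact mul_le_mul (hbd n) (pow_le_pow_left₀ (norm_nonneg _) hz n) (by positivity)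
        (norm_nonneg _)
    have hsm : ∀ ρ : ℝ, 0 ≤ ρ → ρ < 1 → Summable fun n : ℕ => ‖g‖ * ρ ^ n := fun ρ h0 h1 =>
      (summable_geometric_of_lt_one h0 h1).mul_left _
    let F : ℂ → ℂ := fun z => ∑' n, a n * z ^ n
    have ha : TaylorOnDisc F a := by
      intro z hz
      have hz' : ‖z‖ < 1 := by simpa using hz
      exact (Summable.of_norm_bounded (hsm ‖z‖ (norm_nonneg _) hz')
        fun n => hterm _ n z le_rfl).hasSum
    have hd : DifferentiableOn ℂ F unitDisc := by
      intro z hz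
      have hz' : ‖z‖ < 1 := by simpa using hz
      obtain ⟨ρ, h1, h2⟩ := exists_between hz'
      have hdρ : DifferentiableOn ℂ F (Metric.ball 0 ρ) :=
        Complex.differentiableOn_tsum_of_summable_norm
          (hsm ρ ((norm_nonneg z).trans h1.le) h2) (fun n => by fun_prop) Metric.isOpen_ball
          fun n w hw => hterm ρ n w (by simpa using (Metric.mem_ball.1 hw).le)
      exact ((hdρ z (by simpa using h1)).differentiableAt
        (Metric.isOpen_ball.mem_nhds (by simpa using h1))).differentiableWithinAt
    refine ⟨F, ⟨hd, ‖g‖ ^ 2, fun r h0 h1 => ?_⟩, ha.hasBoundaryFunction hrep⟩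
    obtain ⟨G, hG, hco⟩ := ha.exists_continuous h0 h1
    have h2 : ‖ContinuousMap.toLp 2 circleMeasure ℂ G‖ ^ 2
        = ∫ θ, ‖ContinuousMap.toLp 2 circleMeasure ℂ G θ‖ ^ 2 ∂circleMeasure := by
      have h3 := inner_self_eq_norm_sq (𝕜 := ℂ) (ContinuousMap.toLp 2 circleMeasure ℂ G)
      rw [← h3, L2.inner_def, ← integral_re (L2.integrable_inner _ _)]
      exact integral_congr_ae (ae_of_all _ fun θ => inner_self_eq_norm_sq (𝕜 := ℂ) _)
    have h4 : ∫ θ, ‖dilate F r θ‖ ^ 2 ∂circleMeasure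
        = ‖ContinuousMap.toLp 2 circleMeasure ℂ G‖ ^ 2 := by
      rw [h2, ← hG]
      refine integral_congr_ae ?_
      filter_upwards [ContinuousMap.coeFn_toLp (p := 2) (𝕜 := ℂ) circleMeasure G] with θ h
      rw [h]
    rw [h4]
    refine hasSum_le (fun n => ?_) (hasSum_normSq_of_repr hco) hsq
    rw [norm_mul, mul_pow, norm_pow, Complex.norm_real, Real.norm_eq_abs, abs_of_nonneg h0]
    exact mul_le_of_le_one_right (by positivity)
      (pow_le_one₀ (by positivity) (pow_le_one₀ h0 h1.le))

/-! ### The Hardy spaces and Toeplitz operators -/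

/-- The Hardy space `H²`, as the space of boundary functions in `L²(𝕋)` of the functions of
`H²(𝔻)`. -/
def hardySpace : Submodule ℂ (Lp ℂ 2 circleMeasure) where
  carrier := {g | ∃ F, MemHardyTwo F ∧ HasBoundaryFunction F g}
  zero_mem' := (hardy_boundary_iff 0).2 fun k _ => by simp
  add_mem' := fun {f g} hf hg => (hardy_boundary_iff _).2 fun k hk => by
    have h1 := (hardy_boundary_iff f).1 hf k hk
    have h2 := (hardy_boundary_iff g).1 hg k hk
    rw [map_add, lp.coeFn_add, Pi.add_apply, h1, h2, add_zero]
  smul_mem' := fun c f hf => (hardy_boundary_iff _).2 fun k hk => by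
    have h1 := (hardy_boundary_iff f).1 hf k hk
    rw [map_smul, lp.coeFn_smul, Pi.smul_apply, h1, smul_zero]

theorem isClosed_hardySpace : IsClosed (hardySpace : Set (Lp ℂ 2 circleMeasure)) := by
  have h : (hardySpace : Set (Lp ℂ 2 circleMeasure))
      = ⋂ k : ℤ, ⋂ _ : k < 0, {g | inner ℂ (fourierLp 2 k : Lp ℂ 2 circleMeasure) g = 0} := by
    ext g
    have := hardy_boundary_iff g
    simp only [HilbertBasis.repr_apply_apply, coe_fourierBasis] at this
    change (∃ F, MemHardyTwo F ∧ HasBoundaryFunction F g) ↔ _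
    simpa using this
  rw [h]
  exact isClosed_iInter fun k => isClosed_iInter fun _ =>
    isClosed_eq (continuous_const.inner continuous_id) continuous_const

instance instCompleteSpaceHardySpace : CompleteSpace hardySpace :=
  isClosed_hardySpace.completeSpace_coe

/-- The space `H^∞(𝔻)`: functions that are bounded and holomorphic on the disc (the values
outside the disc are irrelevant). -/
def HInfty : Type := {F : ℂ → ℂ // MemHInfty F}

instance instCoeFunHInfty : CoeFun HInfty fun _ => ℂ → ℂ := ⟨fun φ => φ.1⟩

/-- The boundary function in `L^∞(𝕋)` of a function of `H^∞(𝔻)`. -/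
def HInfty.boundary (φ : HInfty) : Lp ℂ ∞ circleMeasure := φ.2.exists_boundary.choose

theorem HInfty.hasBoundaryFunction (φ : HInfty) : HasBoundaryFunction φ φ.boundary :=
  φ.2.exists_boundary.choose_spec

/-- Multiplication by a symbol `u ∈ L^∞(𝕋)` on `L²(𝕋)`. -/
def multiplicationOp (u : Lp ℂ ∞ circleMeasure) :
    Lp ℂ 2 circleMeasure →L[ℂ] Lp ℂ 2 circleMeasure :=
  (ContinuousLinearMap.mul ℂ ℂ).holderL circleMeasure ∞ 2 2 u

/-- The Toeplitz operator `T_u : f ↦ P₊ (u f)` on `H²` with symbol `u ∈ L^∞(𝕋)`, where `P₊` is the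
orthogonal projection of `L²(𝕋)` onto `H²`. -/
def toeplitz (u : Lp ℂ ∞ circleMeasure) : hardySpace →L[ℂ] hardySpace :=
  hardySpace.orthogonalProjectionOnto.comp ((multiplicationOp u).comp hardySpace.subtypeL)

/-- The analytic Toeplitz operator `T_φ` on `H²` with symbol `φ ∈ H^∞`. -/
def analyticToeplitz (φ : HInfty) : hardySpace →L[ℂ] hardySpace := toeplitz φ.boundary

/-! ### Outer functions -/

/-- The function `z ↦ i γ + ∫ (ζ + z) / (ζ - z) log k(ζ) dm(ζ)` on the disc. -/
def outerExponent (γ : ℝ) (k : UnitAddCircle → ℝ) (z : ℂ) : ℂ :=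
  Complex.I * γ +
    ∫ θ, (circlePoint θ + z) / (circlePoint θ - z) * (Real.log (k θ) : ℂ) ∂circleMeasure

/-- `F (z) = exp (i γ) exp (∫ (ζ + z) / (ζ - z) log k(ζ) dm(ζ))` on the disc, where `γ` is real,
`k > 0` almost everywhere and `log k ∈ L¹(𝕋)`. -/
structure IsCanonicalRepresentation (F : ℂ → ℂ) (γ : ℝ) (k : UnitAddCircle → ℝ) : Prop where
  pos : ∀ᵐ θ ∂circleMeasure, 0 < k θ
  integrable_log : Integrable (fun θ => Real.log (k θ)) circleMeasure
  eq_exp : ∀ z ∈ unitDisc, F z = Complex.exp (outerExponent γ k z)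

/-- A function is outer if it has a canonical representation. -/
def IsOuter (F : ℂ → ℂ) : Prop := ∃ γ k, IsCanonicalRepresentation F γ k

end

/-! ### Boundary functions -/

/-! Write `φ = exp h` on the disc, with `h` the exponent of the canonical representation.
Integrability of `log k` makes `h` holomorphic (`differentiableOn_outerExponent`), and boundedness
of `φ` gives `Re h ≤ M` for some `M ≥ 0` (`exists_re_le`), because `|φ| = exp (Re h)`. Hence `φ_t =
exp (t h)` is holomorphic, bounded by `exp (t M)`, and multiplicative in `t`.

Multiplication by an `H^∞` boundary function maps `H²` into itself, so the projection in the
Toeplitz operator does nothing (`coe_analyticToeplitz`). The semigroup laws then reduce to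
multiplicativity of boundary functions (`HasBoundaryFunction.mul_ae_eq`).

For strong continuity, it suffices to let `t → 0`. The operators are uniformly bounded for `t < 1`,
so convergence need only be tested on the exponentials `e_n`, whose span is dense in `L²`. There
`⟨e_n, φ_t e_n⟩` is the mean of `φ_t`, that is `φ_t(0) = exp (t h(0)) → 1`, while `‖φ_t e_n‖ ≤ exp
(t M) → 1`. Expanding the square gives `‖φ_t e_n - e_n‖ → 0`
(`norm_multiplicationOp_fourierLp_sub_sq_le`), with no information on the boundary values of `h`. -/

theorem exists_seq_radius :
    ∃ r : ℕ → ℝ, (∀ n, 0 ≤ r n ∧ r n < 1) ∧ Tendsto r atTop (𝓝[<] 1) := by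
  refine ⟨fun n => 1 - 1 / ((n : ℝ) + 1), fun n => ⟨?_, ?_⟩, tendsto_nhdsWithin_iff.2
    ⟨by simpa using (tendsto_one_div_add_atTop_nhds_zero_nat (𝕜 := ℝ)).const_sub 1,
      Eventually.of_forall fun n => ?_⟩⟩
  · have : 1 / ((n : ℝ) + 1) ≤ 1 := by
      rw [div_le_one (by positivity)]; linarith [n.cast_nonneg (α := ℝ)]
    linarith
  · have : 0 < 1 / ((n : ℝ) + 1) := by positivity
    linarith
  · have : 0 < 1 / ((n : ℝ) + 1) := by positivity
    rw [mem_Iio]; linarith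

theorem aestronglyMeasurable_dilate {F : ℂ → ℂ} (hF : DifferentiableOn ℂ F unitDisc) {r : ℝ}
    (h0 : 0 ≤ r) (h1 : r < 1) : AEStronglyMeasurable (dilate F r) circleMeasure := by
  obtain ⟨a, ha⟩ := exists_taylorOnDisc hF
  obtain ⟨G, hG, -⟩ := ha.exists_continuous h0 h1
  rw [← hG]
  exact G.continuous.aestronglyMeasurable

theorem memLp_dilate {F : ℂ → ℂ} (hF : DifferentiableOn ℂ F unitDisc) {r : ℝ}
    (h0 : 0 ≤ r) (h1 : r < 1) (p : ℝ≥0∞) : MemLp (dilate F r) p circleMeasure := by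
  obtain ⟨a, ha⟩ := exists_taylorOnDisc hF
  obtain ⟨G, hG, -⟩ := ha.exists_continuous h0 h1
  rw [← hG]
  exact MemLp.of_bound G.continuous.aestronglyMeasurable ‖G‖ (ae_of_all _ G.norm_coe_le_norm)

theorem HasBoundaryFunction.congr_ae {F : ℂ → ℂ} {g g' : UnitAddCircle → ℂ}
    (hg : HasBoundaryFunction F g) (h : g =ᵐ[circleMeasure] g') : HasBoundaryFunction F g' :=
  Tendsto.congr (fun _ => eLpNorm_congr_ae (EventuallyEq.rfl.sub h)) hg

theorem HasBoundaryFunction.congr_disc {F F' : ℂ → ℂ} {g : UnitAddCircle → ℂ}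
    (hg : HasBoundaryFunction F g) (h : ∀ z ∈ unitDisc, F z = F' z) :
    HasBoundaryFunction F' g := by
  refine Tendsto.congr' ?_ hg
  filter_upwards [eventually_radius] with r hr
  have : dilate F r = dilate F' r := funext fun θ => h _ (mul_circlePoint_mem hr.1 hr.2 θ)
  rw [this]

/-- Along a subsequence of a sequence of radii increasing to `1`, the dilates tend to the boundary
function almost everywhere. -/
theorem HasBoundaryFunction.exists_subseq {F : ℂ → ℂ} {g : UnitAddCircle → ℂ}
    (hg : HasBoundaryFunction F g) (hF : DifferentiableOn ℂ F unitDisc)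
    (hgm : AEStronglyMeasurable g circleMeasure) {r : ℕ → ℝ} (hr : ∀ n, 0 ≤ r n ∧ r n < 1)
    (hr1 : Tendsto r atTop (𝓝[<] 1)) :
    ∃ ns : ℕ → ℕ, StrictMono ns ∧
      ∀ᵐ θ ∂circleMeasure, Tendsto (fun i => dilate F (r (ns i)) θ) atTop (𝓝 (g θ)) :=
  (tendstoInMeasure_of_tendsto_eLpNorm (p := 2) (by norm_num)
    (fun n => aestronglyMeasurable_dilate hF (hr n).1 (hr n).2) hgm
    (hg.comp hr1)).exists_seq_tendsto_ae

/-- Both functions are almost everywhere limits of the same dilates once the second subsequence is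
extracted from the first. -/
theorem HasBoundaryFunction.ae_eq {F : ℂ → ℂ} {g g' : UnitAddCircle → ℂ}
    (hg : HasBoundaryFunction F g) (hg' : HasBoundaryFunction F g')
    (hF : DifferentiableOn ℂ F unitDisc) (hgm : AEStronglyMeasurable g circleMeasure)
    (hgm' : AEStronglyMeasurable g' circleMeasure) : g =ᵐ[circleMeasure] g' := by
  obtain ⟨r, hr, hr1⟩ := exists_seq_radius
  obtain ⟨ns, hns, h1⟩ := hg.exists_subseq hF hgm hr hr1
  obtain ⟨ms, hms, h2⟩ := hg'.exists_subseq hF hgm' (fun n => hr (ns n))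
    (hr1.comp hns.tendsto_atTop)
  filter_upwards [h1, h2] with θ h1 h2
  exact tendsto_nhds_unique (h1.comp hms.tendsto_atTop) h2

theorem HasBoundaryFunction.ae_norm_le {F : ℂ → ℂ} {g : UnitAddCircle → ℂ}
    (hg : HasBoundaryFunction F g) (hF : DifferentiableOn ℂ F unitDisc)
    (hgm : AEStronglyMeasurable g circleMeasure) {C : ℝ} (hC : ∀ z ∈ unitDisc, ‖F z‖ ≤ C) :
    ∀ᵐ θ ∂circleMeasure, ‖g θ‖ ≤ C := by
  obtain ⟨r, hr, hr1⟩ := exists_seq_radius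
  obtain ⟨ns, -, h⟩ := hg.exists_subseq hF hgm hr hr1
  filter_upwards [h] with θ h
  exact le_of_tendsto h.norm (Eventually.of_forall fun i =>
    hC _ (mul_circlePoint_mem (hr _).1 (hr _).2 θ))

/-- Convergence in `L²` does not pass to products, but almost everywhere convergence does. Three
successively refined subsequences of radii make the dilates of both factors and of the product
converge almost everywhere, and pointwise limits are unique. -/
theorem HasBoundaryFunction.mul_ae_eq {F G : ℂ → ℂ} {f g h : UnitAddCircle → ℂ}
    (hf : HasBoundaryFunction F f) (hg : HasBoundaryFunction G g)
    (hh : HasBoundaryFunction (fun z => F z * G z) h)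
    (hF : DifferentiableOn ℂ F unitDisc) (hG : DifferentiableOn ℂ G unitDisc)
    (hfm : AEStronglyMeasurable f circleMeasure) (hgm : AEStronglyMeasurable g circleMeasure)
    (hhm : AEStronglyMeasurable h circleMeasure) :
    (fun θ => f θ * g θ) =ᵐ[circleMeasure] h := by
  obtain ⟨r, hr, hr1⟩ := exists_seq_radius
  obtain ⟨ns, hns, h1⟩ := hf.exists_subseq hF hfm hr hr1
  have hr2 := hr1.comp hns.tendsto_atTop
  obtain ⟨ms, hms, h2⟩ := hg.exists_subseq hG hgm (fun n => hr (ns n)) hr2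
  obtain ⟨ks, hks, h3⟩ := hh.exists_subseq (hF.mul hG) hhm (fun n => hr (ns (ms n)))
    (hr2.comp hms.tendsto_atTop)
  filter_upwards [h1, h2, h3] with θ h1 h2 h3
  exact tendsto_nhds_unique
    (((h1.comp hms.tendsto_atTop).comp hks.tendsto_atTop).mul (h2.comp hks.tendsto_atTop)) h3

theorem MemHInfty.mul_memHardyTwo {F G : ℂ → ℂ} (hF : MemHInfty F) (hG : MemHardyTwo G) :
    MemHardyTwo fun z => F z * G z := by
  obtain ⟨hd, C, hC⟩ := hF
  obtain ⟨hd', C', hC'⟩ := hG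
  refine ⟨hd.mul hd', C ^ 2 * C', fun r h0 h1 => ?_⟩
  have hint := (memLp_dilate hd' h0 h1 2).integrable_norm_pow (by norm_num)
  calc ∫ θ, ‖dilate (fun z => F z * G z) r θ‖ ^ 2 ∂circleMeasure
      ≤ ∫ θ, C ^ 2 * ‖dilate G r θ‖ ^ 2 ∂circleMeasure := by
        refine integral_mono_of_nonneg (ae_of_all _ fun _ => by positivity)
          (hint.const_mul _) (ae_of_all _ fun θ => ?_)
        have h2 : ‖dilate (fun z => F z * G z) r θ‖
            = ‖F (r * circlePoint θ)‖ * ‖dilate G r θ‖ := norm_mul _ _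
        simp only [h2, mul_pow]
        exact mul_le_mul_of_nonneg_right
          (pow_le_pow_left₀ (norm_nonneg _) (hC _ (mul_circlePoint_mem h0 h1 θ)) 2)
          (by positivity)
    _ ≤ C ^ 2 * C' := by
        rw [integral_const_mul]
        exact mul_le_mul_of_nonneg_left (hC' r h0 h1) (by positivity)

/-! ### Multiplication operators -/

/-- `HInfty.boundary` is obtained by choice from a function on all of `ℂ`. Uniqueness of boundary
functions shows that neither the choice nor the values off the disc matter. -/
theorem HInfty.boundary_congr {φ ψ : HInfty} (h : ∀ z ∈ unitDisc, φ z = ψ z) :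
    φ.boundary = ψ.boundary :=
  Lp.ext ((φ.hasBoundaryFunction.congr_disc h).ae_eq ψ.hasBoundaryFunction ψ.2.1
    (Lp.aestronglyMeasurable _) (Lp.aestronglyMeasurable _))

theorem analyticToeplitz_congr {φ ψ : HInfty} (h : ∀ z ∈ unitDisc, φ z = ψ z) :
    analyticToeplitz φ = analyticToeplitz ψ := by
  rw [analyticToeplitz, HInfty.boundary_congr h, analyticToeplitz]

theorem coeFn_multiplicationOp (u : Lp ℂ ∞ circleMeasure) (f : Lp ℂ 2 circleMeasure) :
    multiplicationOp u f =ᵐ[circleMeasure] fun θ => u θ * f θ := by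
  filter_upwards [(ContinuousLinearMap.mul ℂ ℂ).coeFn_holder (r := 2) u f] with θ h
  exact h

theorem norm_multiplicationOp_le (φ : HInfty) {C : ℝ} (hC : ∀ z ∈ unitDisc, ‖φ z‖ ≤ C)
    (f : Lp ℂ 2 circleMeasure) : ‖multiplicationOp φ.boundary f‖ ≤ C * ‖f‖ := by
  refine Lp.norm_le_mul_norm_of_ae_le_mul ?_
  filter_upwards [coeFn_multiplicationOp φ.boundary f, φ.hasBoundaryFunction.ae_norm_le φ.2.1
    (Lp.aestronglyMeasurable _) hC] with θ h1 h2
  rw [h1, norm_mul]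
  exact mul_le_mul_of_nonneg_right h2 (norm_nonneg _)

theorem multiplicationOp_of_eq_mul {φ ψ χ : HInfty} (h : ∀ z ∈ unitDisc, χ z = φ z * ψ z)
    (f : Lp ℂ 2 circleMeasure) : multiplicationOp χ.boundary f
      = multiplicationOp φ.boundary (multiplicationOp ψ.boundary f) := by
  have hm := φ.hasBoundaryFunction.mul_ae_eq ψ.hasBoundaryFunction
    (χ.hasBoundaryFunction.congr_disc h) φ.2.1 ψ.2.1 (Lp.aestronglyMeasurable _)
    (Lp.aestronglyMeasurable _) (Lp.aestronglyMeasurable _)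
  refine Lp.ext ?_
  filter_upwards [hm, coeFn_multiplicationOp χ.boundary f, coeFn_multiplicationOp ψ.boundary f,
    coeFn_multiplicationOp φ.boundary (multiplicationOp ψ.boundary f)] with θ h1 h2 h3 h4
  rw [h2, h4, h3, ← h1, mul_assoc]

theorem hasBoundaryFunction_one : HasBoundaryFunction (fun _ => 1) fun _ => 1 := by
  have : ∀ r, dilate (fun _ => 1) r - (fun _ => (1 : ℂ)) = 0 := fun r => by
    funext θ; simp [dilate]
  simp [HasBoundaryFunction, this]

theorem multiplicationOp_of_eq_one {φ : HInfty} (h : ∀ z ∈ unitDisc, φ z = 1)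
    (f : Lp ℂ 2 circleMeasure) : multiplicationOp φ.boundary f = f := by
  have hm := (φ.hasBoundaryFunction.congr_disc h).ae_eq hasBoundaryFunction_one
    (differentiableOn_const _) (Lp.aestronglyMeasurable _) aestronglyMeasurable_const
  refine Lp.ext ?_
  filter_upwards [hm, coeFn_multiplicationOp φ.boundary f] with θ h1 h2
  rw [h2, h1, one_mul]

/-- The Hardy space is invariant under multiplication by boundary functions of `H^∞`. -/
theorem multiplicationOp_mem (φ : HInfty) {f : Lp ℂ 2 circleMeasure} (hf : f ∈ hardySpace) :
    multiplicationOp φ.boundary f ∈ hardySpace := by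
  obtain ⟨F, hF, hFf⟩ := hf
  have hm := φ.2.mul_memHardyTwo hF
  obtain ⟨g, hg⟩ := hm.exists_boundary
  have h := φ.hasBoundaryFunction.mul_ae_eq hFf hg φ.2.1 hF.1 (Lp.aestronglyMeasurable _)
    (Lp.aestronglyMeasurable _) (Lp.aestronglyMeasurable _)
  exact ⟨_, hm, hg.congr_ae (h.symm.trans (coeFn_multiplicationOp _ _).symm)⟩

/-- The product already lies in `H²`, where the projection is the identity. All later computations
can therefore take place in `L²` with plain multiplication operators. -/
theorem coe_analyticToeplitz (φ : HInfty) (f : hardySpace) :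
    (analyticToeplitz φ f : Lp ℂ 2 circleMeasure) = multiplicationOp φ.boundary f :=
  Submodule.starProjection_eq_self_iff.2 (multiplicationOp_mem φ f.2)

/-- Since `|e_k| = 1`, the exponentials cancel and the inner product is the mean of the boundary
function for every `k`, negative ones included. This mean is the zeroth Fourier coefficient, hence
the zeroth Taylor coefficient. -/
theorem inner_fourierLp_multiplicationOp (φ : HInfty) (k : ℤ) :
    inner ℂ (fourierLp 2 k : Lp ℂ 2 circleMeasure)
      (multiplicationOp φ.boundary (fourierLp 2 k)) = φ 0 := by
  obtain ⟨a, ha⟩ := exists_taylorOnDisc φ.2.1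
  obtain ⟨g, hg⟩ := φ.2.memHardyTwo.exists_boundary
  have hae := φ.hasBoundaryFunction.ae_eq hg φ.2.1 (Lp.aestronglyMeasurable _)
    (Lp.aestronglyMeasurable _)
  have h0 := ha.repr_eq hg 0
  have ha0 : φ 0 = a 0 := by
    have h1 := ha 0 (by simp)
    refine h1.unique ?_
    simpa using hasSum_single (f := fun n => a n * (0 : ℂ) ^ n) 0 fun n hn => by simp [hn]
  rw [ha0]
  change fourierBasis.repr g 0 = a 0 at h0
  rw [← h0, HilbertBasis.repr_apply_apply, coe_fourierBasis, L2.inner_def, L2.inner_def]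
  refine integral_congr_ae ?_
  filter_upwards [hae, coeFn_fourierLp (T := 1) 2 k, coeFn_fourierLp (T := 1) 2 0,
    coeFn_multiplicationOp φ.boundary (fourierLp 2 k)] with θ h1 h2 h3 h4
  rw [h4, h2, h3, h1]
  simp only [RCLike.inner_apply, fourier_zero, map_one, mul_one]
  rw [mul_assoc, Complex.mul_conj, Complex.normSq_eq_norm_sq, fourier_apply, Circle.norm_coe]
  simp

/-- Expand the square, using `‖e_k‖ = 1` and `‖φ e_k‖ ≤ C`. The bound is small as soon as `C` and `φ
0` are both close to `1`. -/
theorem norm_multiplicationOp_fourierLp_sub_sq_le (φ : HInfty) {C : ℝ}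
    (hC : ∀ z ∈ unitDisc, ‖φ z‖ ≤ C) (k : ℤ) :
    ‖multiplicationOp φ.boundary (fourierLp 2 k) - fourierLp 2 k‖ ^ 2
      ≤ C ^ 2 + 1 - 2 * (φ 0).re := by
  have hk : ‖(fourierLp 2 k : Lp ℂ 2 circleMeasure)‖ = 1 := orthonormal_fourier.1 k
  have h1 := norm_multiplicationOp_le φ hC (fourierLp 2 k)
  rw [hk, mul_one] at h1
  rw [norm_sub_rev, @norm_sub_sq ℂ, inner_fourierLp_multiplicationOp, hk]
  have h2 := pow_le_pow_left₀ (norm_nonneg _) h1 2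
  simp only [RCLike.re_to_complex]
  linarith

/-! ### Strong continuity -/

/-- A multiplicative family of operators with an exponential bound whose orbits are continuous
at `0` is a `C₀`-semigroup. -/
theorem isC0Semigroup_of_tendsto_zero {E : Type*} [NormedAddCommGroup E] [NormedSpace ℂ E]
    {S : ℝ≥0 → E →L[ℂ] E} {M : ℝ} (hM : 0 ≤ M) (h0 : S 0 = ContinuousLinearMap.id ℂ E)
    (hadd : ∀ t s : ℝ≥0, S (t + s) = (S t).comp (S s))
    (hbound : ∀ (t : ℝ≥0) x, ‖S t x‖ ≤ Real.exp (t * M) * ‖x‖)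
    (hlim : ∀ x, Tendsto (fun t => S t x) (𝓝 0) (𝓝 x)) : IsC0Semigroup S := by
  refine ⟨h0, hadd, fun x => continuous_iff_continuousAt.2 fun s => ?_⟩
  -- Factor `S u - S t = S t (S (u - t) - Id)`. The difference `u - t` is written as `nndist u t` so
  -- that one expression serves both one-sided limits.
  have key : ∀ t u : ℝ≥0, t ≤ u →
      ‖S u x - S t x‖ ≤ Real.exp (t * M) * ‖S (nndist u t) x - x‖ := by
    intro t u h
    obtain ⟨v, rfl⟩ := exists_add_of_le h
    have hv : nndist (t + v) t = v := by
      rw [NNReal.nndist_eq]; simp [add_left_comm]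
    rw [hv, hadd, ContinuousLinearMap.comp_apply, ← map_sub]
    exact hbound _ _
  -- For `t ≤ s` the factor `exp (t M)` is enlarged to `exp (s M)`, which needs `M ≥ 0`. The
  -- constant is then independent of `t` on both sides of `s`.
  have key2 : ∀ t : ℝ≥0,
      ‖S t x - S s x‖ ≤ Real.exp (s * M) * ‖S (nndist t s) x - x‖ := by
    intro t
    rcases le_total s t with h | h
    · exact key s t h
    · rw [norm_sub_rev, nndist_comm]
      exact (key t s h).trans (by gcongr)
  rw [ContinuousAt, tendsto_iff_norm_sub_tendsto_zero]
  refine squeeze_zero (fun _ => norm_nonneg _) key2 ?_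
  have h1 : Tendsto (fun t : ℝ≥0 => nndist t s) (𝓝 s) (𝓝 0) := by
    have : Continuous fun t : ℝ≥0 => nndist t s := by fun_prop
    simpa using this.tendsto s
  have h2 := (tendsto_iff_norm_sub_tendsto_zero.1 (hlim x)).comp h1
  simpa using h2.const_mul (Real.exp (s * M))

/-- Pointwise convergence to the identity on a set with dense span extends to the whole space for
a uniformly bounded family of operators. -/
theorem tendsto_self_of_dense_span {E ι : Type*} [NormedAddCommGroup E] [NormedSpace ℂ E]
    {l : Filter ι} {S : ι → E →L[ℂ] E} {K : ℝ} (hK : ∀ᶠ i in l, ∀ x, ‖S i x‖ ≤ K * ‖x‖)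
    {A : Set E} (hA : (Submodule.span ℂ A).topologicalClosure = ⊤)
    (hlim : ∀ x ∈ A, Tendsto (fun i => S i x) l (𝓝 x)) (x : E) :
    Tendsto (fun i => S i x) l (𝓝 x) := by
  have hspan : ∀ y ∈ Submodule.span ℂ A, Tendsto (fun i => S i y) l (𝓝 y) := by
    intro y hy
    induction hy using Submodule.span_induction with
    | mem y hy => exact hlim y hy
    | zero => simpa using tendsto_const_nhds
    | add y z _ _ h1 h2 => simpa using h1.add h2
    | smul c y _ h => simpa using h.const_smul c
  have hx : x ∈ closure (Submodule.span ℂ A : Set E) := by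
    rw [← Submodule.topologicalClosure_coe, hA]; trivial
  rw [Metric.tendsto_nhds]
  intro ε hε
  -- With `δ = ε / (|K| + 2)` the three terms of the triangle inequality add up to `|K| δ + δ + δ =
  -- ε`. The absolute value avoids assuming `K ≥ 0`.
  have hK' : 0 < |K| + 2 := by positivity
  obtain ⟨y, hy, hxy⟩ := Metric.mem_closure_iff.1 hx (ε / (|K| + 2)) (by positivity)
  filter_upwards [hK, Metric.tendsto_nhds.1 (hspan y hy) (ε / (|K| + 2)) (by positivity)]
    with i h1 h2
  have h3 : ‖S i x - S i y‖ ≤ |K| * dist x y := by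
    rw [← map_sub, dist_eq_norm]
    exact (h1 _).trans (mul_le_mul_of_nonneg_right (le_abs_self K) (norm_nonneg _))
  have h4 := mul_le_mul_of_nonneg_left hxy.le (abs_nonneg K)
  have h5 : dist (S i x) x ≤ dist (S i x) (S i y) + dist (S i y) y + dist y x :=
    dist_triangle4 _ _ _ _
  rw [← dist_eq_norm] at h3
  rw [dist_comm y x] at h5
  have h6 : |K| * (ε / (|K| + 2)) + ε / (|K| + 2) + ε / (|K| + 2) = ε := by
    field_simp; ring
  linarith

/-! ### The exponent of an outer function -/

theorem circlePoint_sub_ne_zero {z : ℂ} (hz : z ∈ unitDisc) (θ : UnitAddCircle) :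
    circlePoint θ - z ≠ 0 := by
  intro h
  have h1 := norm_circlePoint θ
  rw [sub_eq_zero.1 h] at h1
  rw [mem_ball_zero_iff] at hz
  linarith

theorem continuous_circlePoint : Continuous circlePoint :=
  continuous_subtype_val.comp AddCircle.continuous_toCircle

theorem continuous_herglotzKernel {z : ℂ} (hz : z ∈ unitDisc) :
    Continuous fun θ => (circlePoint θ + z) / (circlePoint θ - z) :=
  (continuous_circlePoint.add continuous_const).div (continuous_circlePoint.sub continuous_const)
    (circlePoint_sub_ne_zero hz)

theorem hasDerivAt_herglotzKernel {z : ℂ} (hz : z ∈ unitDisc) (θ : UnitAddCircle) :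
    HasDerivAt (fun w => (circlePoint θ + w) / (circlePoint θ - w))
      (2 * circlePoint θ / (circlePoint θ - z) ^ 2) z := by
  have h := ((hasDerivAt_id z).const_add (circlePoint θ)).div
    ((hasDerivAt_id z).const_sub (circlePoint θ)) (circlePoint_sub_ne_zero hz θ)
  refine h.congr_deriv ?_
  congr 1
  simp only [id]
  ring

/-- Differentiate under the integral sign. On a smaller disc `|z| < ρ < 1` the `z`-derivative of the
kernel is at most `2 / (1 - ρ)²`, so a multiple of `|log k|` dominates. -/
theorem differentiableOn_outerExponent (γ : ℝ) {k : UnitAddCircle → ℝ}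
    (hk : Integrable (fun θ => Real.log (k θ)) circleMeasure) :
    DifferentiableOn ℂ (outerExponent γ k) unitDisc := by
  intro z₀ hz₀
  have hz₀' : ‖z₀‖ < 1 := by simpa using hz₀
  obtain ⟨ρ, h1, h2⟩ := exists_between hz₀'
  have hρ : ∀ z ∈ Metric.ball (0 : ℂ) ρ, z ∈ unitDisc :=
    fun z hz => Metric.ball_subset_ball h2.le hz
  have hkm : AEStronglyMeasurable (fun θ => (Real.log (k θ) : ℂ)) circleMeasure :=
    hk.ofReal.aestronglyMeasurable
  have hmeas : ∀ z ∈ unitDisc, AEStronglyMeasurable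
      (fun θ => (circlePoint θ + z) / (circlePoint θ - z) * (Real.log (k θ) : ℂ))
      circleMeasure := fun z hz => (continuous_herglotzKernel hz).aestronglyMeasurable.mul hkm
  have hs : Metric.ball (0 : ℂ) ρ ∈ 𝓝 z₀ := Metric.isOpen_ball.mem_nhds (by simpa using h1)
  have hlow : ∀ z ∈ Metric.ball (0 : ℂ) ρ, ∀ θ, 1 - ρ ≤ ‖circlePoint θ - z‖ := by
    intro z hz θ
    have h3 := norm_sub_norm_le (circlePoint θ) z
    rw [norm_circlePoint] at h3
    rw [mem_ball_zero_iff] at hz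
    linarith
  have hpos : 0 < 1 - ρ := by linarith
  obtain ⟨B, hB⟩ := (isCompact_range (continuous_herglotzKernel hz₀)).isBounded.exists_norm_le
  have hint : Integrable
      (fun θ => (circlePoint θ + z₀) / (circlePoint θ - z₀) * (Real.log (k θ) : ℂ))
      circleMeasure :=
    hk.ofReal.bdd_mul (continuous_herglotzKernel hz₀).aestronglyMeasurable
      (ae_of_all _ fun θ => hB _ (mem_range_self θ))
  have hmeas' : AEStronglyMeasurable
      (fun θ => 2 * circlePoint θ / (circlePoint θ - z₀) ^ 2 * (Real.log (k θ) : ℂ))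
      circleMeasure := by
    refine AEStronglyMeasurable.mul (Continuous.aestronglyMeasurable ?_) hkm
    exact (continuous_const.mul continuous_circlePoint).div
      ((continuous_circlePoint.sub continuous_const).pow 2)
      fun θ => pow_ne_zero 2 (circlePoint_sub_ne_zero hz₀ θ)
  have hbd : ∀ θ, ∀ z ∈ Metric.ball (0 : ℂ) ρ,
      ‖2 * circlePoint θ / (circlePoint θ - z) ^ 2 * (Real.log (k θ) : ℂ)‖
        ≤ 2 / (1 - ρ) ^ 2 * ‖Real.log (k θ)‖ := by
    intro θ z hz
    rw [norm_mul, norm_div, norm_mul, norm_circlePoint, norm_pow, Complex.norm_real, mul_one,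
      Complex.norm_ofNat]
    exact mul_le_mul_of_nonneg_right (div_le_div_of_nonneg_left zero_le_two (by positivity)
      (pow_le_pow_left₀ hpos.le (hlow z hz θ) 2)) (norm_nonneg _)
  have hder := hasDerivAt_integral_of_dominated_loc_of_deriv_le (μ := circleMeasure)
    (F := fun z θ => (circlePoint θ + z) / (circlePoint θ - z) * (Real.log (k θ) : ℂ))
    (F' := fun z θ => 2 * circlePoint θ / (circlePoint θ - z) ^ 2 * (Real.log (k θ) : ℂ))
    (bound := fun θ => 2 / (1 - ρ) ^ 2 * ‖Real.log (k θ)‖) hs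
    (eventually_of_mem hs fun z hz => hmeas z (hρ z hz)) hint hmeas' (ae_of_all _ hbd)
    (hk.norm.const_mul _)
    (ae_of_all _ fun θ z hz => (hasDerivAt_herglotzKernel (hρ z hz) θ).mul_const _)
  exact (hder.2.const_add (Complex.I * γ)).differentiableAt.differentiableWithinAt

/-! ### The semigroup -/

theorem IsCanonicalRepresentation.exists_re_le {F : ℂ → ℂ} {γ : ℝ} {k : UnitAddCircle → ℝ}
    (h : IsCanonicalRepresentation F γ k) (hF : MemHInfty F) :
    ∃ M : ℝ, 0 ≤ M ∧ ∀ z ∈ unitDisc, (outerExponent γ k z).re ≤ M := by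
  obtain ⟨-, C, hC⟩ := hF
  -- The maximum with `1` keeps the logarithm nonnegative, so that `exp (t M)` is nondecreasing in
  -- `t`.
  refine ⟨Real.log (max C 1), Real.log_nonneg (le_max_right _ _), fun z hz => ?_⟩
  rw [Real.le_log_iff_exp_le (by positivity), ← Complex.norm_exp, ← h.eq_exp z hz]
  exact (hC z hz).trans (le_max_left _ _)

theorem norm_exp_mul_le {w : ℂ} {M : ℝ} (h : w.re ≤ M) (t : ℝ≥0) :
    ‖Complex.exp ((t : ℂ) * w)‖ ≤ Real.exp (t * M) := by
  have : ((t : ℂ) * w).re = t * w.re := Complex.re_ofReal_mul _ _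
  rw [Complex.norm_exp, this]
  gcongr

/-- Exponentials of a holomorphic function with real part bounded above are the symbols of a
`C₀`-semigroup of analytic Toeplitz operators. -/
theorem isC0Semigroup_analyticToeplitz {h : ℂ → ℂ} {M : ℝ} (hM : 0 ≤ M)
    (hre : ∀ z ∈ unitDisc, (h z).re ≤ M) {Φ : ℝ≥0 → HInfty}
    (hΦ : ∀ t, ∀ z ∈ unitDisc, Φ t z = Complex.exp ((t : ℂ) * h z)) :
    IsC0Semigroup fun t => analyticToeplitz (Φ t) := by
  have hb : ∀ t, ∀ z ∈ unitDisc, ‖Φ t z‖ ≤ Real.exp (t * M) := fun t z hz => by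
    rw [hΦ t z hz]
    exact norm_exp_mul_le (hre z hz) t
  refine isC0Semigroup_of_tendsto_zero hM ?_ (fun t s => ?_) (fun t f => ?_) fun f => ?_
  · ext1 f
    refine Subtype.ext ?_
    rw [coe_analyticToeplitz]
    exact multiplicationOp_of_eq_one (fun z hz => by simp [hΦ 0 z hz]) _
  · ext1 f
    refine Subtype.ext ?_
    rw [ContinuousLinearMap.comp_apply, coe_analyticToeplitz, coe_analyticToeplitz,
      coe_analyticToeplitz]
    refine multiplicationOp_of_eq_mul (fun z hz => ?_) _
    rw [hΦ _ z hz, hΦ _ z hz, hΦ _ z hz, ← Complex.exp_add, ← add_mul]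
    simp
  · rw [Submodule.coe_norm, coe_analyticToeplitz]
    exact norm_multiplicationOp_le _ (hb t) _
  · rw [tendsto_subtype_rng]
    simp only [coe_analyticToeplitz]
    -- The limit is proved for the multiplication operators on all of `L²`, where the exponentials
    -- of every integer frequency have dense span. The bound `exp M` is valid for `t < 1`, which
    -- suffices near `0`.
    refine tendsto_self_of_dense_span (K := Real.exp M) ?_
      (span_fourierLp_closure_eq_top (T := 1) (p := 2) (by norm_num)) ?_ _
    · filter_upwards [gt_mem_nhds (show (0 : ℝ≥0) < 1 by norm_num)] with t ht f
      refine (norm_multiplicationOp_le _ (hb t) f).trans ?_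
      have ht' : (t : ℝ) ≤ 1 := by exact_mod_cast ht.le
      gcongr
      exact mul_le_of_le_one_left hM ht'
    · rintro _ ⟨n, rfl⟩
      rw [tendsto_iff_norm_sub_tendsto_zero]
      -- At `t = 0` the radicand is `1 + 1 - 2 = 0`, so continuity in `t` gives the limit.
      have hlim : Tendsto (fun t : ℝ≥0 => Real.sqrt
          (Real.exp (t * M) ^ 2 + 1 - 2 * (Complex.exp ((t : ℂ) * h 0)).re)) (𝓝 0) (𝓝 0) := by
        have hc : Continuous fun t : ℝ≥0 => Real.sqrt
          (Real.exp (t * M) ^ 2 + 1 - 2 * (Complex.exp (((t : ℝ) : ℂ) * h 0)).re) := by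
          fun_prop
        have := hc.tendsto 0
        norm_num at this
        exact this
      refine squeeze_zero (fun _ => norm_nonneg _) (fun t => Real.le_sqrt_of_sq_le ?_) hlim
      rw [← hΦ t 0 (by simp)]
      exact norm_multiplicationOp_fourierLp_sub_sq_le _ (hb t) n

theorem mainTheorem7 (φ : HInfty) (hφ : IsOuter φ) :
    (∃ S : ℝ≥0 → hardySpace →L[ℂ] hardySpace,
      IsC0Semigroup S ∧ S 1 = analyticToeplitz φ ∧
        ∀ t, ∃ ψ : HInfty, S t = analyticToeplitz ψ) ∧
    ∀ (γ : ℝ) (k : UnitAddCircle → ℝ), IsCanonicalRepresentation φ γ k →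
      ∃ Φ : ℝ≥0 → HInfty,
        (∀ t, ∀ z ∈ unitDisc, Φ t z = Complex.exp ((t : ℂ) * outerExponent γ k z)) ∧
        (∀ z ∈ unitDisc, Φ 1 z = φ z) ∧
        IsC0Semigroup (fun t => analyticToeplitz (Φ t)) ∧
        analyticToeplitz (Φ 1) = analyticToeplitz φ := by
  have main : ∀ (γ : ℝ) (k : UnitAddCircle → ℝ), IsCanonicalRepresentation φ γ k →
      ∃ Φ : ℝ≥0 → HInfty,
        (∀ t, ∀ z ∈ unitDisc, Φ t z = Complex.exp ((t : ℂ) * outerExponent γ k z)) ∧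
        (∀ z ∈ unitDisc, Φ 1 z = φ z) ∧
        IsC0Semigroup (fun t => analyticToeplitz (Φ t)) ∧
        analyticToeplitz (Φ 1) = analyticToeplitz φ := by
    intro γ k h
    obtain ⟨M, hM, hre⟩ := h.exists_re_le φ.2
    let Φ : ℝ≥0 → HInfty := fun t =>
      ⟨fun z => Complex.exp ((t : ℂ) * outerExponent γ k z),
        ((differentiableOn_outerExponent γ h.integrable_log).const_mul _).cexp,
        Real.exp (t * M), fun z hz => norm_exp_mul_le (hre z hz) t⟩
    have hΦ : ∀ t, ∀ z ∈ unitDisc, Φ t z = Complex.exp ((t : ℂ) * outerExponent γ k z) :=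
      fun _ _ _ => rfl
    have h1 : ∀ z ∈ unitDisc, Φ 1 z = φ z := fun z hz => by
      rw [hΦ 1 z hz, h.eq_exp z hz]
      simp
    exact ⟨Φ, hΦ, h1, isC0Semigroup_analyticToeplitz hM hre hΦ, analyticToeplitz_congr h1⟩
  refine ⟨?_, main⟩
  -- Any one canonical representation of `φ` provides the embedding.
  obtain ⟨γ, k, h⟩ := hφ
  obtain ⟨Φ, -, -, hS, h1⟩ := main γ k h
  exact ⟨_, hS, h1, fun t => ⟨Φ t, rfl⟩⟩
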